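/- Fix $j>0$. For a finite positive Borel measure $\mu$ on $[0,1]$ put $F(r;\mu)=\mu([r,1])$, $r\in[0,1]$; a function $\rho\in L^\infty([0,1],\mathbb R_+)$ is identified with the measure $\rho(r)\,dr$. Let $D_0$ be the Dirac measure at $0$, let $\mathcal U$ be the set of measures $u=c_uD_0+\rho_u(r)\,dr$ with $c_u\ge 0$ and $\rho_u\in L^\infty([0,1],\mathbb R_+)$, and write $u\le v$ iff $F(r;u)\le F(r;v)$ for all $r\in[0,1]$. For $\delta>0$ let $\mathcal U_\delta=\{u\in\mathcal U: F(0;\rho_u)>j\delta\}$ and, for $u\in\mathcal U_\delta$, $$K^{(\delta)}u=j\delta D_0+\mathbf 1_{[0,R_\delta(u)]}u,\qquad R_\delta(u)=\inf\{r\in[0,1]:F(r;u)=j\delta\}.$$ For $t>0$ let $$G^{\rm neum}_t(r,r')=\sum_{k\in\mathbb Z}\big(G_t(r,2k+r')+G_t(r,2k-r')\big),\qquad G_t(r,r')=\frac{e^{-(r-r')^2/(2t)}}{\sqrt{2\pi t}},$$ be the Green function of $\partial_t=\frac12\partial_r^2$ on $[0,1]$ with Neumann boundary conditions, and let $G^{\rm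 neum}_t*u$ be the measure on $[0,1]$ with density $r\mapsto\int G^{\rm neum}_t(r,r')\,u(dr')$. The barriers are defined by $S^{(\delta,\pm)}_0(u)=u$ and, for integers $n\ge1$, $$S^{(\delta,-)}_{n\delta}(u)=K^{(\delta)}\big(G^{\rm neum}_\delta*S^{(\delta,-)}_{(n-1)\delta}(u)\big),\qquad S^{(\delta,+)}_{n\delta}(u)=G^{\rm neum}_\delta*\big(K^{(\delta)}S^{(\delta,+)}_{(n-1)\delta}(u)\big).$$ **Theorem (Macroscopic inequalities).** Let $u\in L^\infty([0,1],\mathbb R_+)$ with $F(0;u)>0$, let $\delta>0$ satisfy $j\delta<F(0;u)$, and let $\delta=k\delta'$ with $k$ a positive integer. Then for every integer $m\ge0$ $$S^{(\delta,-)}_{m\delta}(u)\le S^{(\delta',-)}_{m\delta}(u)\le S^{(\delta',+)}_{m\delta}(u)\le S^{(\delta,+)}_{m\delta}(u).$$ Moreover the following maps preserve the order $\le$: for every $\delta>0$, the map $K^{(\delta)}$ on $\mathcal U_\delta$; for every $t>0$, the map $u\mapsto G^{\rm neum}_t*u$ on $\mathcal U$ (in particular on every $\mathcal U_\delta$); and,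 for every $\delta>0$ and every integer $n\ge0$, the maps $S^{(\delta,\pm)}_{n\delta}$ on $\mathcal U_\delta$. -/

import Mathlib

open MeasureTheory

namespace Barrier

/-- Lebesgue measure `dr` on the interval `[0,1]`. Borel measures on `[0,1]` are represented
by measures on `ℝ` that are carried by `[0,1]`. -/
noncomputable def leb : Measure ℝ := volume.restrict (Set.Icc 0 1)

/-- `ρ ∈ L^∞([0,1], ℝ₊)`: measurable and essentially bounded on `[0,1]`, and nonnegative
almost everywhere there. -/
def IsBddDensity (ρ : ℝ → ℝ) : Prop :=
  MemLp ρ ⊤ leb ∧ 0 ≤ᵐ[leb] ρ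

/-- The measure `ρ(r) dr` on `[0,1]`. -/
noncomputable def densityMeasure (ρ : ℝ → ℝ) : Measure ℝ :=
  leb.withDensity (fun r => ENNReal.ofReal (ρ r))

/-- The tail mass `F(r; μ) = ∫_r^1 μ(dr') = μ([r,1])`. -/
noncomputable def F (r : ℝ) (μ : Measure ℝ) : ENNReal := μ (Set.Icc r 1)

/-- The set `𝒰` of measures `c D₀ + ρ(r) dr` on `[0,1]`, with `c ≥ 0` and
`ρ ∈ L^∞([0,1], ℝ₊)`. -/
def U : Set (Measure ℝ) :=
  {u | ∃ (c : ℝ) (ρ : ℝ → ℝ), 0 ≤ c ∧ IsBddDensity ρ ∧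
    u = ENNReal.ofReal c • Measure.dirac 0 + densityMeasure ρ}

/-- The subset `𝒰_δ` of those `u = c D₀ + ρ dr` in `𝒰` with `F(0; ρ) > j δ`
(the point mass at `0` is not counted). -/
def UDelta (j δ : ℝ) : Set (Measure ℝ) :=
  {u | ∃ (c : ℝ) (ρ : ℝ → ℝ), 0 ≤ c ∧ IsBddDensity ρ ∧
    u = ENNReal.ofReal c • Measure.dirac 0 + densityMeasure ρ ∧
    ENNReal.ofReal (j * δ) < F 0 (densityMeasure ρ)}

/-- The mass-transport order: `u ≤ v` iff `F(r; u) ≤ F(r; v)` for all `r ∈ [0,1]`. -/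
def MassLE (u v : Measure ℝ) : Prop :=
  ∀ r ∈ Set.Icc (0 : ℝ) 1, F r u ≤ F r v

/-- `R_δ(u) = inf {r ∈ [0,1] : F(r; u) = j δ}`. -/
noncomputable def cutPoint (j δ : ℝ) (u : Measure ℝ) : ℝ :=
  sInf {r : ℝ | r ∈ Set.Icc (0 : ℝ) 1 ∧ F r u = ENNReal.ofReal (j * δ)}

/-- The cut-and-paste operator `K^{(δ)} u = j δ D₀ + 1_{[0, R_δ(u)]} u`
(meaningful for `u ∈ 𝒰_δ`). -/
noncomputable def K (j δ : ℝ) (u : Measure ℝ) : Measure ℝ :=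
  ENNReal.ofReal (j * δ) • Measure.dirac 0 + u.restrict (Set.Icc 0 (cutPoint j δ u))

/-- The heat kernel on the line, `G_t(r,r') = exp(-(r-r')²/(2t)) / √(2πt)`. -/
noncomputable def heatKernel (t r r' : ℝ) : ℝ :=
  Real.exp (-(r - r') ^ 2 / (2 * t)) / Real.sqrt (2 * Real.pi * t)

/-- The Green function of `∂_t = ½ ∂_r²` on `[0,1]` with Neumann boundary conditions: the sum of
the heat kernel over the images `2k + r'` and `2k - r'`, `k ∈ ℤ`, of `r'` under repeated
reflections of `[0,1]` at its end points. -/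
noncomputable def neumannKernel (t r r' : ℝ) : ENNReal :=
  ∑' k : ℤ, (ENNReal.ofReal (heatKernel t r (2 * k + r')) +
    ENNReal.ofReal (heatKernel t r (2 * k - r')))

/-- The measure `G_t^neum * u` on `[0,1]`, with density `r ↦ ∫ G_t^neum(r,r') u(dr')`. -/
noncomputable def neumannConv (t : ℝ) (u : Measure ℝ) : Measure ℝ :=
  leb.withDensity (fun r => ∫⁻ r', neumannKernel t r r' ∂u)

/-- The lower barrier after `n` steps, i.e. at time `n δ`:
`S^{(δ,-)}_0(u) = u` and `S^{(δ,-)}_{nδ}(u) = K^{(δ)} (G_δ^neum * S^{(δ,-)}_{(n-1)δ}(u))`. -/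
noncomputable def lowerBarrier (j δ : ℝ) : ℕ → Measure ℝ → Measure ℝ
  | 0, u => u
  | n + 1, u => K j δ (neumannConv δ (lowerBarrier j δ n u))

/-- The upper barrier after `n` steps, i.e. at time `n δ`:
`S^{(δ,+)}_0(u) = u` and `S^{(δ,+)}_{nδ}(u) = G_δ^neum * (K^{(δ)} S^{(δ,+)}_{(n-1)δ}(u))`. -/
noncomputable def upperBarrier (j δ : ℝ) : ℕ → Measure ℝ → Measure ℝ
  | 0, u => u
  | n + 1, u => neumannConv δ (K j δ (upperBarrier j δ n u))

end Barrier

/-! The order sees only the tails F(r;·), on which both building blocks act simply. When the mass on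
(0,1] exceeds jδ, the cut is truncated subtraction of jδ for r > 0 and keeps the total mass F(0;·)
(`F_K`, `F_zero_K`); hence it is monotone, and successive cuts add up. The Neumann flow G keeps the
total mass and preserves every comparison F(r;u) ≤ F(r;v) + b with a constant defect b
(`F_neumannConv_le`).

Together these give K G u ≤ G K u (`K_neumannConv_le`): let F(r;u) ≤ F(r;Ku) + jδ flow, then
subtract jδ. Induction yields lower ≤ upper. Moving all cuts of a block ahead of the flows yields
fine upper ≤ coarse upper. Since k fine lower steps remove at most k j δ' from any tail of the pure
flow, coarse lower ≤ fine lower.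

The analytic core is that the Neumann flow preserves monotone functions on [0,1]. Its kernel is a
folded Gaussian, so this concerns the heat flow of even 2-periodic functions. Reflection coupling
handles one wall; ignoring the other costs the probability of a displacement of at least 1/4, which
is O(s²) in time s. Over n steps of length t/n the total error is O(t²/n), which vanishes in the
limit (`ApproxMono.heat_zero`).

Everything runs in the class `Admissible`, stable under cut and flow, so bounds on densities need
not be tracked. -/

namespace Barrier

open ProbabilityTheory Filter Topology
open scoped NNReal

/-! ### Heat flow preserves monotonicity of folded functions -/

/-- The heat semigroup on the line, acting on functions. -/
noncomputable def heat (s : ℝ≥0) (h : ℝ → ℝ) (x : ℝ) : ℝ := ∫ z, h (x + z) ∂gaussianReal 0 s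

/-- Measurable functions with values in `[0,1]` that are even and `2`-periodic, i.e. factor
through the folding of the line onto `[0,1]`. -/
structure IsFolded (h : ℝ → ℝ) : Prop where
  measurable : Measurable h
  nonneg : ∀ x, 0 ≤ h x
  le_one : ∀ x, h x ≤ 1
  even : ∀ x, h (-x) = h x
  periodic : ∀ x, h (x + 2) = h x

/-- `h` is nondecreasing on `[0,1]` up to an error `ε`. -/
def ApproxMono (ε : ℝ) (h : ℝ → ℝ) : Prop :=
  ∀ x y, 0 ≤ x → x ≤ y → y ≤ 1 → h x ≤ h y + ε

lemma integrable_of_mem_unit {α : Type*} [MeasurableSpace α] {μ : Measure α} [IsFiniteMeasure μ]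
    {h : α → ℝ} (hm : Measurable h) (h0 : ∀ x, 0 ≤ h x) (h1 : ∀ x, h x ≤ 1) : Integrable h μ :=
  Integrable.of_bound hm.aestronglyMeasurable 1
    (Eventually.of_forall fun x => by rw [Real.norm_eq_abs, abs_of_nonneg (h0 x)]; exact h1 x)

lemma IsFolded.integrable {h : ℝ → ℝ} (hh : IsFolded h) (μ : Measure ℝ) [IsFiniteMeasure μ]
    (x : ℝ) : Integrable (fun z => h (x + z)) μ :=
  integrable_of_mem_unit (hh.measurable.comp (measurable_const_add x)) (fun _ => hh.nonneg _)
    fun _ => hh.le_one _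

lemma heat_neg_arg (s : ℝ≥0) {h : ℝ → ℝ} (hm : Measurable h) (x : ℝ) :
    ∫ z, h (x - z) ∂gaussianReal 0 s = heat s h x := by
  have h1 : (gaussianReal 0 s).map (fun z => -z) = gaussianReal 0 s := by
    rw [gaussianReal_map_neg, neg_zero]
  unfold heat
  conv_rhs => rw [← h1]
  rw [integral_map (φ := fun z : ℝ => -z) (f := fun z => h (x + z)) measurable_neg.aemeasurable
    (hm.comp (measurable_const_add x)).aestronglyMeasurable]
  simp [sub_eq_add_neg]

lemma measurable_heat (s : ℝ≥0) {h : ℝ → ℝ} (hm : Measurable h) : Measurable (heat s h) := by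
  have : StronglyMeasurable (fun p : ℝ × ℝ => h (p.1 + p.2)) :=
    (hm.comp (measurable_fst.add measurable_snd)).stronglyMeasurable
  exact (this.integral_prod_right (ν := gaussianReal 0 s)).measurable

lemma IsFolded.heat {h : ℝ → ℝ} (hh : IsFolded h) (s : ℝ≥0) : IsFolded (heat s h) where
  measurable := measurable_heat s hh.measurable
  nonneg x := integral_nonneg fun z => hh.nonneg _
  le_one x := by
    have := integral_mono (hh.integrable (gaussianReal 0 s) x) (integrable_const 1)
      (fun z => hh.le_one (x + z))
    simpa [Barrier.heat] using this
  even x := by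
    rw [← heat_neg_arg s hh.measurable]
    unfold Barrier.heat
    congr 1; ext z
    rw [← hh.even]; congr 1; ring
  periodic x := by
    unfold Barrier.heat
    congr 1; ext z
    rw [← hh.periodic (x + z)]; congr 1; ring

lemma heat_heat (s t : ℝ≥0) {h : ℝ → ℝ} (hh : IsFolded h) :
    heat s (heat t h) = heat (s + t) h := by
  ext x
  unfold heat
  have hc : gaussianReal 0 (s + t) = gaussianReal 0 s ∗ gaussianReal 0 t := by
    rw [gaussianReal_conv_gaussianReal, add_zero]
  rw [hc, integral_conv (by rw [← hc]; exact hh.integrable _ x)]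
  simp [add_assoc]

lemma heat_eq_integral {s : ℝ≥0} (hs : s ≠ 0) {h : ℝ → ℝ} (hm : Measurable h) (x : ℝ) :
    heat s h x = ∫ z, gaussianPDFReal x s z * h z := by
  have h1 : (gaussianReal 0 s).map (fun z => x + z) = gaussianReal x s := by
    rw [gaussianReal_map_const_add, zero_add]
  have h2 := integral_gaussianReal_eq_integral_smul (μ := x) (f := h) hs
  rw [← h1, integral_map (measurable_const_add x).aemeasurable hm.aestronglyMeasurable] at h2
  simpa [heat] using h2

lemma gaussianPDFReal_le_of_abs_le (s : ℝ≥0) {x y z : ℝ} (h : |z - x| ≤ |z - y|) :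
    gaussianPDFReal y s z ≤ gaussianPDFReal x s z := by
  have := sq_le_sq.2 h
  simp only [gaussianPDFReal_def]
  gcongr

lemma gaussianPDFReal_reflect (s : ℝ≥0) (x y z : ℝ) :
    gaussianPDFReal x s (x + y - z) = gaussianPDFReal y s z := by
  simp only [gaussianPDFReal_def]
  congr 3; ring

/-- Reflection coupling at a single wall. -/
lemma heat_le_of_radial {s : ℝ≥0} (hs : s ≠ 0) {h : ℝ → ℝ} {ε : ℝ} (hm : Measurable h)
    (h0 : ∀ x, 0 ≤ h x) (h1 : ∀ x, h x ≤ 1) (hr : ∀ a b, |a| ≤ |b| → h a ≤ h b + ε)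
    {x y : ℝ} (hx : 0 ≤ x) (hxy : x ≤ y) : heat s h x ≤ heat s h y + ε := by
  have hε : 0 ≤ ε := by linarith [hr 0 0 le_rfl]
  have hi : ∀ (w : ℝ) {k : ℝ → ℝ}, Measurable k → (∀ x, 0 ≤ k x) → (∀ x, k x ≤ 1) →
      Integrable fun z => gaussianPDFReal w s z * k z := by
    intro w k hk k0 k1
    refine (integrable_gaussianPDFReal w s).mul_bdd (c := 1) hk.aestronglyMeasurable ?_
    exact Eventually.of_forall fun z => by rw [Real.norm_eq_abs, abs_of_nonneg (k0 z)]; exact k1 z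
  have hm' : Measurable fun z => h (x + y - z) := hm.comp (measurable_const.sub measurable_id)
  have e1 : ∫ z, gaussianPDFReal x s z * h (x + y - z) = heat s h y := by
    rw [heat_eq_integral hs hm, ← integral_sub_left_eq_self _ volume (x + y)]
    congr 1; ext z
    rw [gaussianPDFReal_reflect, sub_sub_cancel]
  have e2 : ∫ z, gaussianPDFReal y s z * h (x + y - z) = heat s h x := by
    rw [heat_eq_integral hs hm, ← integral_sub_left_eq_self _ volume (x + y)]
    congr 1; ext z
    rw [add_comm x y, gaussianPDFReal_reflect, sub_sub_cancel]
  have i1 := hi x hm h0 h1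
  have i2 := hi y hm h0 h1
  have i3 := hi x hm' (fun _ => h0 _) (fun _ => h1 _)
  have i4 := hi y hm' (fun _ => h0 _) (fun _ => h1 _)
  -- The reflection z ↦ x + y - z swaps the Gaussians centred at x and y, so the sides integrate to
  -- twice `heat s h x` and twice `heat s h y + ε`. Pointwise, whichever of z and its reflection
  -- lies right of the midpoint is larger in modulus, as x, y ≥ 0, and that side favours the
  -- Gaussian at y.
  have key : ∫ z, (gaussianPDFReal x s z * h z + gaussianPDFReal y s z * h (x + y - z)) ≤
      ∫ z, ((gaussianPDFReal y s z * h z + gaussianPDFReal x s z * h (x + y - z)) +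
        ε * (gaussianPDFReal x s z + gaussianPDFReal y s z)) := by
    refine integral_mono (i1.add i4) ((i2.add i3).add
      (((integrable_gaussianPDFReal x s).add (integrable_gaussianPDFReal y s)).const_mul ε)) ?_
    intro z
    have p1 := gaussianPDFReal_nonneg x s z
    have p2 := gaussianPDFReal_nonneg y s z
    simp only
    rcases le_total (x + y) (2 * z) with hz | hz
    · have q1 : gaussianPDFReal x s z ≤ gaussianPDFReal y s z :=
        gaussianPDFReal_le_of_abs_le s (by rw [← sq_le_sq]; nlinarith)
      have q2 := hr (x + y - z) z (by rw [← sq_le_sq]; nlinarith)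
      nlinarith
    · have q1 : gaussianPDFReal y s z ≤ gaussianPDFReal x s z :=
        gaussianPDFReal_le_of_abs_le s (by rw [← sq_le_sq]; nlinarith)
      have q2 := hr z (x + y - z) (by rw [← sq_le_sq]; nlinarith)
      nlinarith
  have i5 : Integrable fun z => ε * (gaussianPDFReal x s z + gaussianPDFReal y s z) :=
    ((integrable_gaussianPDFReal x s).add (integrable_gaussianPDFReal y s)).const_mul ε
  have i6 : Integrable fun z => gaussianPDFReal y s z * h z +
    gaussianPDFReal x s z * h (x + y - z) := i2.add i3
  rw [integral_add i1 i4, integral_add i6 i5, integral_add i2 i3, integral_const_mul, integral_add (integrable_gaussianPDFReal x s)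
    (integrable_gaussianPDFReal y s), integral_gaussianPDFReal_eq_one x hs,
    integral_gaussianPDFReal_eq_one y hs, e1, e2, ← heat_eq_integral hs hm,
    ← heat_eq_integral hs hm] at key
  linarith

/-- The mass that a centred Gaussian puts at distance at least `1/4`. -/
noncomputable def gaussianTail (s : ℝ≥0) : ℝ := (gaussianReal 0 s).real {z | 1 / 4 ≤ |z|}

lemma measurableSet_tail : MeasurableSet {z : ℝ | 1 / 4 ≤ |z|} :=
  measurableSet_le measurable_const measurable_id.abs

lemma integral_le_add_gaussianTail {s : ℝ≥0} {f g : ℝ → ℝ} {ε : ℝ}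
    (hf : Integrable f (gaussianReal 0 s)) (hg : Integrable g (gaussianReal 0 s))
    (h : ∀ z, f z ≤ g z + ε + Set.indicator {z : ℝ | 1 / 4 ≤ |z|} 1 z) :
    ∫ z, f z ∂gaussianReal 0 s ≤ ∫ z, g z ∂gaussianReal 0 s + ε + gaussianTail s := by
  have hi : Integrable (Set.indicator {z : ℝ | 1 / 4 ≤ |z|} (1 : ℝ → ℝ)) (gaussianReal 0 s) :=
    (integrable_const (1 : ℝ)).indicator measurableSet_tail
  have hc : Integrable (fun _ : ℝ => ε) (gaussianReal 0 s) := integrable_const ε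
  have := integral_mono hf ((hg.add hc).add hi) h
  rw [integral_add' (hg.add hc) hi, integral_add' hg hc, integral_indicator_one measurableSet_tail]
    at this
  simpa [gaussianTail] using this

/-- Only the wall at 0 matters when y ≤ 3/4: replacing h by 1 outside [-1,1] makes it radially
monotone up to ε, and from y the change is felt only after a displacement of at least 1/4. -/
lemma heat_le_near_zero {s : ℝ≥0} (hs : s ≠ 0) {h : ℝ → ℝ} {ε : ℝ} (hh : IsFolded h)
    (hε : ApproxMono ε h) {x y : ℝ} (hx : 0 ≤ x) (hxy : x ≤ y) (hy : y ≤ 3 / 4) :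
    heat s h x ≤ heat s h y + ε + gaussianTail s := by
  classical
  have ε0 : 0 ≤ ε := by linarith [hε 0 0 le_rfl le_rfl zero_le_one]
  set k : ℝ → ℝ := fun z => if |z| ≤ 1 then h z else 1 with hk
  have km : Measurable k :=
    Measurable.ite (measurableSet_le measurable_id.abs measurable_const) hh.measurable
      measurable_const
  have k0 : ∀ z, 0 ≤ k z := fun z => by
    simp only [hk]; split_ifs; exacts [hh.nonneg z, zero_le_one]
  have k1 : ∀ z, k z ≤ 1 := fun z => by
    simp only [hk]; split_ifs; exacts [hh.le_one z, le_rfl]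
  have habs : ∀ z, h |z| = h z := fun z => by
    rcases abs_choice z with e | e <;> rw [e]; exact hh.even z
  have kr : ∀ a b, |a| ≤ |b| → k a ≤ k b + ε := by
    intro a b hab
    by_cases hb : |b| ≤ 1
    · simp only [hk, if_pos hb, if_pos (hab.trans hb)]
      rw [← habs a, ← habs b]
      exact hε _ _ (abs_nonneg _) hab hb
    · have : k b = 1 := by simp only [hk, if_neg hb]
      linarith [k1 a]
  have s1 : heat s h x ≤ heat s k x := by
    refine integral_mono (hh.integrable _ x) (integrable_of_mem_unit
      (km.comp (measurable_const_add x)) (fun _ => k0 _) fun _ => k1 _) fun z => ?_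
    simp only [hk]; split_ifs; exacts [le_rfl, hh.le_one _]
  have s2 := heat_le_of_radial hs km k0 k1 kr hx hxy
  have s3 : heat s k y ≤ heat s h y + 0 + gaussianTail s := by
    refine integral_le_add_gaussianTail (integrable_of_mem_unit
      (km.comp (measurable_const_add y)) (fun _ => k0 _) fun _ => k1 _) (hh.integrable _ y)
      fun z => ?_
    by_cases hz : 1 / 4 ≤ |z|
    · simp only [Set.indicator, Set.mem_ofPred_eq, hz, if_true, Pi.one_apply]
      linarith [k1 (y + z), hh.nonneg (y + z)]
    · have : |y + z| ≤ 1 := by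
        rw [not_le] at hz
        have := abs_lt.1 hz
        rw [abs_le]; constructor <;> linarith
      rw [Set.indicator_of_notMem (by exact hz)]
      simp [hk, if_pos this]
  linarith

/-- Exchanges the walls 0 and 1 while keeping the direction of monotonicity, so the estimate near 0
also serves near 1. -/
lemma IsFolded.reflect {h : ℝ → ℝ} (hh : IsFolded h) : IsFolded fun z => 1 - h (1 - z) where
  measurable := (hh.measurable.comp (measurable_const.sub measurable_id)).const_sub 1
  nonneg x := sub_nonneg.2 (hh.le_one _)
  le_one x := by linarith [hh.nonneg (1 - x)]
  even x := by
    rw [← hh.even (1 - x), ← hh.periodic (-(1 - x))]; ring_nf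
  periodic x := by
    rw [← hh.periodic (1 - (x + 2))]; ring_nf

lemma heat_reflect {s : ℝ≥0} {h : ℝ → ℝ} (hh : IsFolded h) (x : ℝ) :
    heat s (fun z => 1 - h (1 - z)) (1 - x) = 1 - heat s h x := by
  rw [← heat_neg_arg s hh.reflect.measurable]
  have : ∀ z, 1 - h (1 - (1 - x - z)) = 1 - h (x + z) := fun z => by ring_nf
  simp only [this]
  rw [integral_sub (integrable_const 1) (hh.integrable _ x)]
  simp [heat]

lemma ApproxMono.heat {s : ℝ≥0} (hs : s ≠ 0) {h : ℝ → ℝ} {ε : ℝ} (hh : IsFolded h)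
    (hε : ApproxMono ε h) : ApproxMono (ε + gaussianTail s) (heat s h) := by
  intro x y hx hxy hy
  have ε0 : 0 ≤ ε := by linarith [hε 0 0 le_rfl le_rfl zero_le_one]
  by_cases hy' : y ≤ 3 / 4
  · linarith [heat_le_near_zero hs hh hε hx hxy hy']
  by_cases hx' : 1 / 4 ≤ x
  · have hr : ApproxMono ε fun z => 1 - h (1 - z) := fun a b ha hab hb => by
      have := hε (1 - b) (1 - a) (by linarith) (by linarith) (by linarith)
      simp only
      linarith
    have := heat_le_near_zero hs hh.reflect hr (x := 1 - y) (y := 1 - x) (by linarith)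
      (by linarith) (by linarith)
    rw [heat_reflect hh, heat_reflect hh] at this
    linarith
  -- Here x < 1/4 and y > 3/4. Moving both points by the same z with |z| < 1/4 keeps the folding of
  -- x + z at most 1/2 and that of y + z at least 1/2, so their order survives.
  · rw [← add_assoc]
    refine integral_le_add_gaussianTail (hh.integrable _ x) (hh.integrable _ y) fun z => ?_
    by_cases hz : 1 / 4 ≤ |z|
    · simp only [Set.indicator, Set.mem_ofPred_eq, hz, if_true, Pi.one_apply]
      linarith [hh.le_one (x + z), hh.nonneg (y + z)]
    · have hz0 := hz
      simp only [Set.indicator, Set.mem_ofPred_eq, hz0, if_false, add_zero]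
      rw [not_le] at hz hx' hy'
      obtain ⟨z1, z2⟩ := abs_lt.1 hz
      have e1 : h |x + z| = h (x + z) := by
        rcases abs_choice (x + z) with e | e <;> rw [e]; exact hh.even _
      rw [← e1]
      have hxz : |x + z| ≤ 1 / 2 := by rw [abs_le]; constructor <;> linarith
      by_cases hyz : y + z ≤ 1
      · exact hε _ _ (abs_nonneg _) (by linarith) hyz
      · have e2 : h (2 - (y + z)) = h (y + z) := by
          rw [← hh.even (y + z), ← hh.periodic (-(y + z))]; ring_nf
        rw [← e2]
        exact hε _ _ (abs_nonneg _) (by linarith) (by linarith)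

/-- Chernoff's bound at the optimal exponent 1/(4s) gives exp(-1/(32s)) ≤ 2(32s)² on each side. Any
bound that is o(s) would do, since the number of steps is of order 1/s. -/
lemma gaussianTail_le (s : ℝ≥0) (hs : s ≠ 0) : gaussianTail s ≤ 4096 * (s : ℝ) ^ 2 := by
  have s0 : (0 : ℝ) < s := by positivity
  have one : ∀ X : ℝ → ℝ, Measurable X → (gaussianReal 0 s).map X = gaussianReal 0 s →
      (gaussianReal 0 s).real {z | 1 / 4 ≤ X z} ≤ 2048 * (s : ℝ) ^ 2 := by
    intro X hXm hX
    have hint : Integrable (fun z => Real.exp ((1 / (4 * s) : ℝ) * X z)) (gaussianReal 0 s) := by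
      have := integrable_exp_mul_gaussianReal (μ := 0) (v := s) (1 / (4 * s) : ℝ)
      rw [← hX] at this
      exact this.comp_measurable hXm
    have h1 := measure_ge_le_exp_mul_mgf (1 / 4 : ℝ) (by positivity) hint
    rw [mgf_gaussianReal hX, ← Real.exp_add] at h1
    have e : -(1 / (4 * s) : ℝ) * (1 / 4) + (0 * (1 / (4 * s)) + s * (1 / (4 * s)) ^ 2 / 2) =
        -(1 / (32 * s)) := by
      field_simp; norm_num
    rw [e, Real.exp_neg] at h1
    have h2 := Real.quadratic_le_exp_of_nonneg (x := 1 / (32 * s)) (by positivity)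
    have h3 : (1 / (32 * s : ℝ)) ^ 2 / 2 ≤ Real.exp (1 / (32 * s)) := by
      have : 0 ≤ (1 / (32 * s : ℝ)) := by positivity
      linarith
    refine h1.trans ((inv_anti₀ (by positivity) h3).trans (le_of_eq ?_))
    field_simp; norm_num
  have hsub : {z : ℝ | 1 / 4 ≤ |z|} = {z | 1 / 4 ≤ id z} ∪ {z | 1 / 4 ≤ -z} := by
    ext z; simp [le_abs]
  have a1 := one id measurable_id Measure.map_id
  have a2 := one (fun z => -z) measurable_neg (by rw [gaussianReal_map_neg, neg_zero])
  unfold gaussianTail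
  rw [hsub]
  refine (measureReal_union_le _ _).trans ?_
  linarith

lemma ApproxMono.heat_nsmul {s : ℝ≥0} (hs : s ≠ 0) {h : ℝ → ℝ} (hh : IsFolded h)
    (h0 : ApproxMono 0 h) (n : ℕ) :
    ApproxMono ((n + 1) * gaussianTail s) (Barrier.heat ((n + 1) * s) h) := by
  induction n with
  | zero => simpa using h0.heat hs hh
  | succ n ih =>
    have := ih.heat hs (hh.heat _)
    rw [heat_heat _ _ hh] at this
    convert this using 2 <;> push_cast <;> ring

lemma ApproxMono.heat_zero {t : ℝ≥0} (ht : t ≠ 0) {h : ℝ → ℝ} (hh : IsFolded h)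
    (h0 : ApproxMono 0 h) : ApproxMono 0 (Barrier.heat t h) := by
  have bound : ∀ n : ℕ, ApproxMono (4096 * (t : ℝ) ^ 2 * (1 / ((n : ℝ) + 1))) (Barrier.heat t h) := by
    intro n x y hx hxy hy
    have hs : t / (n + 1) ≠ 0 := by positivity
    have h1 := h0.heat_nsmul hs hh n x y hx hxy hy
    rw [mul_div_cancel₀ _ (by positivity)] at h1
    have h2 := gaussianTail_le _ hs
    have h3 : ((n : ℝ) + 1) * (4096 * ((t / (n + 1) : ℝ≥0) : ℝ) ^ 2) =
        4096 * (t : ℝ) ^ 2 * (1 / ((n : ℝ) + 1)) := by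
      push_cast; field_simp
    have h4 := mul_le_mul_of_nonneg_left h2 (by positivity : 0 ≤ (n : ℝ) + 1)
    linarith
  intro x y hx hxy hy
  have lim : Tendsto (fun n : ℕ => Barrier.heat t h y + 4096 * (t : ℝ) ^ 2 * (1 / ((n : ℝ) + 1)))
      atTop (𝓝 (Barrier.heat t h y + 4096 * (t : ℝ) ^ 2 * 0)) :=
    tendsto_const_nhds.add (tendsto_one_div_add_atTop_nhds_zero_nat.const_mul _)
  rw [mul_zero] at lim
  exact ge_of_tendsto' lim fun n => bound n x y hx hxy hy

end Barrier

/-! ### The Neumann kernel as a folded Gaussian -/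

namespace Barrier

open ProbabilityTheory Filter Topology
open scoped NNReal ENNReal

/-- The folding of the line onto `[0,1]`: the distance to the nearest even integer. -/
noncomputable def fold (y : ℝ) : ℝ := Real.arccos (Real.cos (Real.pi * y)) / Real.pi

lemma measurable_fold : Measurable fold := by
  unfold fold; fun_prop

lemma fold_of_mem {y : ℝ} (hy : y ∈ Set.Icc (0 : ℝ) 1) : fold y = y := by
  have := Real.pi_pos
  unfold fold
  rw [Real.arccos_cos (by nlinarith [hy.1]) (by nlinarith [hy.2])]
  field_simp

lemma fold_neg (y : ℝ) : fold (-y) = fold y := by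
  unfold fold; rw [mul_neg, Real.cos_neg]

lemma fold_add_two_mul_int (y : ℝ) (k : ℤ) : fold (y + 2 * k) = fold y := by
  unfold fold
  rw [show Real.pi * (y + 2 * k) = Real.pi * y + k * (2 * Real.pi) by ring,
    Real.cos_add_int_mul_two_pi]

lemma fold_add_two (y : ℝ) : fold (y + 2) = fold y := by
  simpa using fold_add_two_mul_int y 1

lemma fold_mem (y : ℝ) : fold y ∈ Set.Icc (0 : ℝ) 1 :=
  ⟨div_nonneg (Real.arccos_nonneg _) Real.pi_pos.le,
    (div_le_one Real.pi_pos).2 (Real.arccos_le_pi _)⟩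

/-- Every point of the line is, up to sign and an even integer, its folding. -/
lemma IsFolded.comp_fold {h : ℝ → ℝ} (hh : IsFolded h) (y : ℝ) : h (fold y) = h y := by
  have per : ∀ (k : ℤ) (x : ℝ), h (x + 2 * k) = h x := fun k x => by
    have : Function.Periodic h 2 := hh.periodic
    have := this.int_mul k x
    rwa [mul_comm (2 : ℝ)]
  have hc : Real.cos (Real.pi * fold y) = Real.cos (Real.pi * y) := by
    unfold fold
    rw [mul_div_cancel₀ _ Real.pi_ne_zero,
      Real.cos_arccos (Real.neg_one_le_cos _) (Real.cos_le_one _)]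
  obtain ⟨k, hk | hk⟩ := Real.cos_eq_cos_iff.1 hc
  · have : y = fold y + 2 * k := by
      have := Real.pi_pos
      refine mul_left_cancel₀ this.ne' ?_
      linarith
    conv_rhs => rw [this, per]
  · have : y = -fold y + 2 * k := by
      have := Real.pi_pos
      refine mul_left_cancel₀ this.ne' ?_
      linarith
    conv_rhs => rw [this, per, hh.even]

/-- The line is cut into the periods (2k-1, 2k+1], and each is folded at its centre 2k onto two
copies of [0,1]. -/
lemma lintegral_eq_lintegral_unit_tsum {g : ℝ → ℝ≥0∞} (hg : Measurable g) :
    ∫⁻ y, g y = ∫⁻ y in Set.Icc (0 : ℝ) 1, ∑' k : ℤ, (g (y + 2 * k) + g (-y + 2 * k)) := by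
  have hd : Pairwise (Function.onFun Disjoint
      fun n : ℤ => Set.Ioc (-1 + n • (2 : ℝ)) (-1 + (n + 1) • (2 : ℝ))) :=
    Set.pairwise_disjoint_Ioc_add_zsmul _ _
  have h1 : ∫⁻ y, g y =
      ∑' k : ℤ, ∫⁻ y in Set.Ioc (-1 + k • (2 : ℝ)) (-1 + (k + 1) • (2 : ℝ)), g y := by
    rw [← lintegral_iUnion (fun _ => measurableSet_Ioc) hd, iUnion_Ioc_add_zsmul (by norm_num),
      setLIntegral_univ]
  have h2 : ∀ k : ℤ, ∫⁻ y in Set.Ioc (-1 + k • (2 : ℝ)) (-1 + (k + 1) • (2 : ℝ)), g y =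
      ∫⁻ y in Set.Icc (0 : ℝ) 1, (g (y + 2 * k) + g (-y + 2 * k)) := by
    intro k
    have e1 : ∫⁻ y in Set.Ioc (-1 + k • (2 : ℝ)) (-1 + (k + 1) • (2 : ℝ)), g y =
        ∫⁻ y in Set.Ioc (-1 : ℝ) 1, g (y + 2 * k) := by
      rw [← lintegral_indicator measurableSet_Ioc, ← lintegral_indicator measurableSet_Ioc,
        ← lintegral_add_right_eq_self _ (2 * (k : ℝ))]
      congr 1; ext y
      simp only [Set.indicator, Set.mem_Ioc, zsmul_eq_mul]
      congr 1
      push_cast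
      refine propext ⟨fun h => ⟨by linarith [h.1], by linarith [h.2]⟩,
        fun h => ⟨by linarith [h.1], by linarith [h.2]⟩⟩
    have e2 : ∫⁻ y in Set.Ioc (-1 : ℝ) 0, g (y + 2 * k) =
        ∫⁻ y in Set.Ioc (0 : ℝ) 1, g (-y + 2 * k) := by
      rw [← restrict_Ioo_eq_restrict_Ioc, ← restrict_Ioo_eq_restrict_Ioc,
        ← lintegral_indicator measurableSet_Ioo, ← lintegral_indicator measurableSet_Ioo,
        ← lintegral_neg_eq_self]
      congr 1; ext y
      simp only [Set.indicator, Set.mem_Ioo]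
      congr 1
      refine propext ⟨fun h => ⟨by linarith [h.2], by linarith [h.1]⟩,
        fun h => ⟨by linarith [h.2], by linarith [h.1]⟩⟩
    rw [e1, ← Set.Ioc_union_Ioc_eq_Ioc (by norm_num : (-1 : ℝ) ≤ 0) zero_le_one,
      lintegral_union measurableSet_Ioc (Set.Ioc_disjoint_Ioc_of_le le_rfl), e2,
      ← restrict_Ioc_eq_restrict_Icc, ← lintegral_add_right _ (by fun_prop), lintegral_congr]
    intro y; rw [add_comm]
  rw [h1, lintegral_tsum (fun k => by fun_prop)]
  exact tsum_congr h2

lemma gaussianPDF_eq_heatKernel {t : ℝ} (ht : 0 < t) (x y : ℝ) :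
    gaussianPDF x t.toNNReal y = ENNReal.ofReal (heatKernel t y x) := by
  simp only [gaussianPDF, gaussianPDFReal_def, heatKernel, Real.coe_toNNReal t ht.le]
  rw [div_eq_inv_mul (Real.exp _)]

lemma heatKernel_eq_of_sq_eq {t a b c d : ℝ} (h : (a - b) ^ 2 = (c - d) ^ 2) :
    heatKernel t a b = heatKernel t c d := by
  unfold heatKernel; rw [h]

/-- The Neumann kernel is the law of a Gaussian folded onto `[0,1]`. -/
lemma lintegral_neumannKernel_mul {t : ℝ} (ht : 0 < t) {f : ℝ → ℝ≥0∞} (hf : Measurable f) (x : ℝ) :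
    ∫⁻ y, neumannKernel t y x * f y ∂leb = ∫⁻ y, f (fold y) ∂gaussianReal x t.toNNReal := by
  have hv : t.toNNReal ≠ 0 := by simpa using ht
  have hff : Measurable fun y => f (fold y) := hf.comp measurable_fold
  rw [gaussianReal_of_var_ne_zero _ hv,
    lintegral_withDensity_eq_lintegral_mul _ (measurable_gaussianPDF _ _) hff,
    lintegral_eq_lintegral_unit_tsum ((measurable_gaussianPDF _ _).mul hff)]
  refine setLIntegral_congr_fun measurableSet_Icc fun y hy => ?_
  simp only [Pi.mul_apply, fold_add_two_mul_int, fold_neg, fold_of_mem hy,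
    gaussianPDF_eq_heatKernel ht, neumannKernel]
  rw [ENNReal.tsum_add, ENNReal.tsum_add, add_mul, ENNReal.tsum_mul_right, ENNReal.tsum_mul_right]
  congr 2
  -- Translating y by 2k amounts to translating the source by -2k; the reflected images match with
  -- the same index.
  · rw [← (Equiv.neg ℤ).tsum_eq]
    refine tsum_congr fun k => ?_
    rw [heatKernel_eq_of_sq_eq]
    simp only [Equiv.neg_apply]; push_cast; ring
  · refine tsum_congr fun k => ?_
    rw [heatKernel_eq_of_sq_eq]
    ring

lemma measurable_neumannKernel (t : ℝ) : Measurable fun p : ℝ × ℝ => neumannKernel t p.1 p.2 := by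
  unfold neumannKernel heatKernel
  fun_prop

lemma lintegral_neumannConv {t : ℝ} (ht : 0 < t) (u : Measure ℝ) [SFinite u] {f : ℝ → ℝ≥0∞}
    (hf : Measurable f) :
    ∫⁻ r, f r ∂neumannConv t u = ∫⁻ x, ∫⁻ y, f (fold y) ∂gaussianReal x t.toNNReal ∂u := by
  have : SFinite leb := by unfold leb; infer_instance
  have hk := measurable_neumannKernel t
  have hd : Measurable fun r => ∫⁻ x, neumannKernel t r x ∂u := hk.lintegral_prod_right'
  unfold neumannConv
  rw [lintegral_withDensity_eq_lintegral_mul _ hd hf]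
  simp only [Pi.mul_apply]
  have h1 : ∀ r, (∫⁻ x, neumannKernel t r x ∂u) * f r = ∫⁻ x, neumannKernel t r x * f r ∂u :=
    fun r => (lintegral_mul_const _ (hk.comp measurable_prodMk_left)).symm
  simp only [h1]
  rw [lintegral_lintegral_swap (hk.mul (hf.comp measurable_fst)).aemeasurable]
  exact lintegral_congr fun x => lintegral_neumannKernel_mul ht hf x

/-- The indicator of the points whose folding is at least `r`. -/
noncomputable def tailIndicator (r : ℝ) : ℝ → ℝ := Set.indicator (fold ⁻¹' Set.Icc r 1) 1

lemma isFolded_tailIndicator (r : ℝ) : IsFolded (tailIndicator r) where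
  measurable := measurable_one.indicator (measurable_fold measurableSet_Icc)
  nonneg x := Set.indicator_nonneg (fun _ _ => zero_le_one) x
  le_one x := Set.indicator_le_self' (fun _ _ => zero_le_one) x
  even x := by simp only [tailIndicator, Set.indicator, Set.mem_preimage, fold_neg, Pi.one_apply]
  periodic x := by simp only [tailIndicator, Set.indicator, Set.mem_preimage, fold_add_two, Pi.one_apply]

lemma approxMono_tailIndicator (r : ℝ) : ApproxMono 0 (tailIndicator r) := by
  intro x y hx hxy hy
  rw [add_zero]
  unfold tailIndicator
  by_cases h : r ≤ x
  · rw [Set.indicator_of_mem, Set.indicator_of_mem]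
    · rfl
    · simpa [fold_of_mem ⟨hx.trans hxy, hy⟩] using ⟨h.trans hxy, hy⟩
    · simpa [fold_of_mem ⟨hx, hxy.trans hy⟩] using ⟨h, hxy.trans hy⟩
  · rw [Set.indicator_of_notMem]
    · exact Set.indicator_nonneg (fun _ _ => zero_le_one) _
    · simp [fold_of_mem ⟨hx, hxy.trans hy⟩, h]

lemma ofReal_heat (s : ℝ≥0) {h : ℝ → ℝ} (hh : IsFolded h) (x : ℝ) :
    ENNReal.ofReal (heat s h x) = ∫⁻ y, ENNReal.ofReal (h y) ∂gaussianReal x s := by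
  have h1 : (gaussianReal 0 s).map (fun z => x + z) = gaussianReal x s := by
    rw [gaussianReal_map_const_add, zero_add]
  rw [← h1, lintegral_map hh.measurable.ennreal_ofReal (measurable_const_add x), heat,
    ofReal_integral_eq_lintegral_ofReal (hh.integrable _ x)
      (Eventually.of_forall fun _ => hh.nonneg _)]

/-- Duality: a folded test function does not notice the folding, so the flow of the measure becomes
the line heat flow of the function. -/
lemma lintegral_neumannConv_of_isFolded {t : ℝ} (ht : 0 < t) (u : Measure ℝ) [SFinite u]
    {h : ℝ → ℝ} (hh : IsFolded h) :
    ∫⁻ r, ENNReal.ofReal (h r) ∂neumannConv t u =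
      ∫⁻ x, ENNReal.ofReal (heat t.toNNReal h x) ∂u := by
  rw [lintegral_neumannConv ht u hh.measurable.ennreal_ofReal]
  simp only [hh.comp_fold, ofReal_heat _ hh]

/-! ### Tail comparisons under the Neumann flow -/

/-- The measure is carried by `[0,1]`. -/
def Carried (u : Measure ℝ) : Prop := u (Set.Icc 0 1)ᶜ = 0

lemma carried_withDensity_leb (f : ℝ → ℝ≥0∞) : Carried (leb.withDensity f) := by
  refine withDensity_absolutelyContinuous _ _ ?_
  unfold leb
  rw [Measure.restrict_apply measurableSet_Icc.compl]
  simp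

lemma carried_neumannConv (t : ℝ) (u : Measure ℝ) : Carried (neumannConv t u) :=
  carried_withDensity_leb _

lemma F_eq_lintegral {u : Measure ℝ} (hu : Carried u) (r : ℝ) :
    F r u = ∫⁻ x, ENNReal.ofReal (tailIndicator r x) ∂u := by
  have h1 : ∀ x ∈ Set.Icc (0 : ℝ) 1, ENNReal.ofReal (tailIndicator r x) =
      Set.indicator (Set.Icc r 1) 1 x := by
    intro x hx
    unfold tailIndicator
    by_cases h : x ∈ Set.Icc r 1
    · rw [Set.indicator_of_mem h, Set.indicator_of_mem]
      · simp
      · simpa [fold_of_mem hx] using h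
    · rw [Set.indicator_of_notMem h, Set.indicator_of_notMem]
      · simp
      · simpa [fold_of_mem hx] using h
  have h2 : (fun x => ENNReal.ofReal (tailIndicator r x)) =ᵐ[u] Set.indicator (Set.Icc r 1) 1 := by
    have : ∀ᵐ x ∂u, x ∈ Set.Icc (0 : ℝ) 1 := by
      rw [ae_iff]; exact hu
    filter_upwards [this] with x hx using h1 x hx
  rw [lintegral_congr_ae h2, lintegral_indicator_one measurableSet_Icc, F]

lemma F_neumannConv {t : ℝ} (ht : 0 < t) (u : Measure ℝ) [SFinite u] (r : ℝ) :
    F r (neumannConv t u) = ∫⁻ x, ENNReal.ofReal (heat t.toNNReal (tailIndicator r) x) ∂u := by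
  rw [F_eq_lintegral (carried_neumannConv t u) r,
    lintegral_neumannConv_of_isFolded ht u (isFolded_tailIndicator r)]

lemma neumannConv_univ {t : ℝ} (ht : 0 < t) (u : Measure ℝ) [SFinite u] :
    neumannConv t u Set.univ = u Set.univ := by
  have := lintegral_neumannConv ht u (f := fun _ => 1) measurable_const
  simpa using this

lemma isFiniteMeasure_neumannConv {t : ℝ} (ht : 0 < t) (u : Measure ℝ) [IsFiniteMeasure u] :
    IsFiniteMeasure (neumannConv t u) :=
  ⟨by rw [neumannConv_univ ht]; exact measure_lt_top u _⟩

/-- The semigroup law is needed only on tails. Duality applies twice because the heat flow of a tail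
indicator is again folded. -/
lemma F_neumannConv_neumannConv {s t : ℝ} (hs : 0 < s) (ht : 0 < t) (u : Measure ℝ)
    [IsFiniteMeasure u] (r : ℝ) :
    F r (neumannConv s (neumannConv t u)) = F r (neumannConv (t + s) u) := by
  have := isFiniteMeasure_neumannConv ht u
  rw [F_neumannConv hs, F_neumannConv (by positivity),
    lintegral_neumannConv_of_isFolded ht u ((isFolded_tailIndicator r).heat _),
    heat_heat _ _ (isFolded_tailIndicator r), Real.toNNReal_add ht.le hs.le]

lemma F_zero_eq_univ {u : Measure ℝ} (hu : Carried u) : F 0 u = u Set.univ := by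
  rw [F, ← measure_add_measure_compl (μ := u) (measurableSet_Icc (a := (0 : ℝ)) (b := 1))]
  rw [hu, add_zero]

lemma F_zero_neumannConv {t : ℝ} (ht : 0 < t) {u : Measure ℝ} [SFinite u] (hu : Carried u) :
    F 0 (neumannConv t u) = F 0 u := by
  rw [F_zero_eq_univ hu, F_zero_eq_univ (carried_neumannConv t u), neumannConv_univ ht]

/-- A tail comparison, up to a defect `b`, passes to all upper subsets of `[0,1]`. -/
lemma measure_upper_le {u v : Measure ℝ} {b : ℝ≥0∞}
    (h : ∀ r ∈ Set.Icc (0 : ℝ) 1, F r u ≤ F r v + b) {A : Set ℝ} (hA : A ⊆ Set.Icc 0 1)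
    (hup : ∀ x ∈ A, ∀ y ≤ 1, x ≤ y → y ∈ A) : u A ≤ v A + b := by
  rcases A.eq_empty_or_nonempty with rfl | hne
  · simp
  have hbdd : BddBelow A := ⟨0, fun x hx => (hA hx).1⟩
  obtain ⟨a, ha, hlim, hmem⟩ := exists_seq_tendsto_sInf hne hbdd
  have hmono : Monotone fun n => Set.Icc (a n) 1 := fun m n hmn => Set.Icc_subset_Icc_left (ha hmn)
  -- An upper set is [a,1], or else (a,1], an increasing union of closed tails to which the bound
  -- passes in the limit.
  by_cases hinf : sInf A ∈ A
  · have : A = Set.Icc (sInf A) 1 := by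
      ext x
      exact ⟨fun hx => ⟨csInf_le hbdd hx, (hA hx).2⟩, fun hx => hup _ hinf x hx.2 hx.1⟩
    rw [this]
    exact h _ (hA hinf)
  · have : A = ⋃ n, Set.Icc (a n) 1 := by
      ext x
      simp only [Set.mem_iUnion]
      constructor
      · intro hx
        have hlt : sInf A < x := lt_of_le_of_ne (csInf_le hbdd hx) fun e => hinf (e ▸ hx)
        obtain ⟨n, hn⟩ := (hlim.eventually_lt_const hlt).exists
        exact ⟨n, hn.le, (hA hx).2⟩
      · rintro ⟨n, hn⟩
        exact hup _ (hmem n) x hn.2 hn.1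
    rw [this, hmono.measure_iUnion, hmono.measure_iUnion]
    refine iSup_le fun n => (h _ (hA (hmem n))).trans ?_
    gcongr
    exact le_iSup (fun n => v (Set.Icc (a n) 1)) n

/-- Layer cake: superlevel sets of f within [0,1] are upper sets. Only levels in (0,1] contribute,
so the defect b is counted with total weight 1 and does not grow. -/
lemma lintegral_le_of_tail_le {u v : Measure ℝ} {b : ℝ≥0∞} (hu : Carried u)
    (h : ∀ r ∈ Set.Icc (0 : ℝ) 1, F r u ≤ F r v + b) {f : ℝ → ℝ} (hf : Measurable f)
    (h0 : ∀ x, 0 ≤ f x) (h1 : ∀ x, f x ≤ 1) (hmono : ApproxMono 0 f) :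
    ∫⁻ x, ENNReal.ofReal (f x) ∂u ≤ (∫⁻ x, ENNReal.ofReal (f x) ∂v) + b := by
  have key : ∀ s : ℝ, u {x | s ≤ f x} ≤ v {x | s ≤ f x} + b := by
    intro s
    calc u {x | s ≤ f x} ≤ u ({x | s ≤ f x} ∩ Set.Icc 0 1) + u (Set.Icc 0 1)ᶜ := by
          refine (measure_mono fun x hx => ?_).trans (measure_union_le _ _)
          by_cases hx' : x ∈ Set.Icc (0 : ℝ) 1
          · exact Or.inl ⟨hx, hx'⟩
          · exact Or.inr hx'
      _ = u ({x | s ≤ f x} ∩ Set.Icc 0 1) := by rw [hu, add_zero]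
      _ ≤ v ({x | s ≤ f x} ∩ Set.Icc 0 1) + b := by
          refine measure_upper_le h Set.inter_subset_right fun x hx y hy hxy =>
            ⟨?_, hx.2.1.trans hxy, hy⟩
          have := hmono x y hx.2.1 hxy hy
          have hs : s ≤ f x := hx.1
          exact hs.trans (by simpa using this)
      _ ≤ v {x | s ≤ f x} + b := by gcongr; exact Set.inter_subset_left
  have red : ∀ w : Measure ℝ, ∫⁻ x, ENNReal.ofReal (f x) ∂w =
      ∫⁻ s in Set.Ioc (0 : ℝ) 1, w {x | s ≤ f x} := by
    intro w
    rw [lintegral_eq_lintegral_meas_le w (Eventually.of_forall h0) hf.aemeasurable,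
      ← Set.Ioc_union_Ioi_eq_Ioi (zero_le_one (α := ℝ)),
      lintegral_union measurableSet_Ioi (Set.Ioc_disjoint_Ioi le_rfl)]
    have : ∫⁻ s in Set.Ioi (1 : ℝ), w {x | s ≤ f x} = 0 := by
      rw [setLIntegral_congr_fun (g := fun _ => 0) measurableSet_Ioi]
      · simp
      · intro s hs
        have : {x | s ≤ f x} = ∅ := by
          ext x
          have := h1 x
          have : (1 : ℝ) < s := hs
          simp; linarith
        simp only [this, measure_empty]
    rw [this, add_zero]
  rw [red, red]
  calc ∫⁻ s in Set.Ioc (0 : ℝ) 1, u {x | s ≤ f x}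
      ≤ ∫⁻ s in Set.Ioc (0 : ℝ) 1, (v {x | s ≤ f x} + b) := lintegral_mono fun s => key s
    _ = (∫⁻ s in Set.Ioc (0 : ℝ) 1, v {x | s ≤ f x}) + b := by
        rw [lintegral_add_right _ measurable_const]; simp

/-- Tail comparisons, up to a defect, are preserved by the Neumann heat flow. -/
lemma F_neumannConv_le {t : ℝ} (ht : 0 < t) {u v : Measure ℝ} [SFinite u] [SFinite v]
    (hu : Carried u) {b : ℝ≥0∞} (h : ∀ r ∈ Set.Icc (0 : ℝ) 1, F r u ≤ F r v + b) (r : ℝ) :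
    F r (neumannConv t u) ≤ F r (neumannConv t v) + b := by
  have hf := (isFolded_tailIndicator r).heat t.toNNReal
  rw [F_neumannConv ht u, F_neumannConv ht v]
  exact lintegral_le_of_tail_le hu h hf.measurable hf.nonneg hf.le_one
    ((approxMono_tailIndicator r).heat_zero (by simpa using ht) (isFolded_tailIndicator r))

end Barrier

/-! ### The cut-and-paste operator on tails -/

namespace Barrier

open ProbabilityTheory Filter Topology
open scoped NNReal ENNReal

/-- Finite measures on `[0,1]` with no atoms except possibly at `0`. -/
structure Admissible (u : Measure ℝ) : Prop where
  finite : IsFiniteMeasure u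
  carried : Carried u
  noAtom : ∀ x, x ≠ 0 → u {x} = 0

lemma F_antitone (u : Measure ℝ) {r s : ℝ} (h : r ≤ s) : F s u ≤ F r u :=
  measure_mono (Set.Icc_subset_Icc_left h)

lemma F_zero_pos_part_le (u : Measure ℝ) : u (Set.Ioc 0 1) ≤ F 0 u :=
  measure_mono Set.Ioc_subset_Icc_self

namespace Admissible

variable {u : Measure ℝ}

lemma measure_Ioc (hu : Admissible u) {r : ℝ} (hr : r ≠ 0) (s : ℝ) :
    u (Set.Ioc r s) = u (Set.Icc r s) := by
  refine le_antisymm (measure_mono Set.Ioc_subset_Icc_self) ?_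
  calc u (Set.Icc r s) ≤ u ({r} ∪ Set.Ioc r s) := measure_mono fun x hx => by
        rcases hx.1.eq_or_lt with h | h
        · exact Or.inl h.symm
        · exact Or.inr ⟨h, hx.2⟩
    _ ≤ u {r} + u (Set.Ioc r s) := measure_union_le _ _
    _ = u (Set.Ioc r s) := by rw [hu.noAtom r hr, zero_add]

lemma continuousOn_tail (hu : Admissible u) :
    ContinuousOn (fun r => u.real (Set.Ioc r 1)) (Set.Icc 0 1) := by
  have := hu.finite
  -- Removing the possible atom at 0 makes the tail continuous up to r = 0, where F itself may jump.
  set μ := u.restrict (Set.Ioi 0) with hμ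
  have : NullSingletonClass μ := ⟨fun x => by
    rw [hμ, Measure.restrict_apply (measurableSet_singleton x)]
    by_cases hx : x = 0
    · subst hx; simp
    · exact measure_mono_null Set.inter_subset_left (hu.noAtom x hx)⟩
  have hc : Continuous fun b : ℝ => ∫ _ in (1 : ℝ)..b, (1 : ℝ) ∂μ :=
    intervalIntegral.continuous_primitive (fun a b => intervalIntegrable_const) 1
  refine hc.neg.continuousOn.congr fun r hr => ?_
  have hsub : Set.Ioc r 1 ∩ Set.Ioi 0 = Set.Ioc r 1 :=
    Set.inter_eq_left.2 fun x hx => hr.1.trans_lt hx.1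
  rw [Pi.neg_apply, ← intervalIntegral.integral_symm, intervalIntegral.integral_of_le hr.2]
  simp [hμ, measureReal_def, hsub]

/-- The intermediate value theorem makes the level set nonempty, and continuity makes it closed, so
the infimum is attained; it is not 0 because F(0;u) exceeds jδ. -/
lemma cutPoint_spec (hu : Admissible u) {j δ : ℝ}
    (h : ENNReal.ofReal (j * δ) < u (Set.Ioc 0 1)) :
    cutPoint j δ u ∈ Set.Ioc (0 : ℝ) 1 ∧ F (cutPoint j δ u) u = ENNReal.ofReal (j * δ) := by
  have := hu.finite
  set a := ENNReal.ofReal (j * δ) with ha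
  have hafin : a ≠ ∞ := ENNReal.ofReal_ne_top
  set S := {r : ℝ | r ∈ Set.Icc (0 : ℝ) 1 ∧ F r u = a} with hS
  have hS' : S = Set.Icc 0 1 ∩ (fun r => u.real (Set.Ioc r 1)) ⁻¹' {a.toReal} := by
    ext r
    simp only [hS, Set.mem_ofPred_eq, Set.mem_inter_iff, Set.mem_preimage, Set.mem_singleton_iff,
      measureReal_def, ENNReal.toReal_eq_toReal_iff' (measure_ne_top u _) hafin]
    refine and_congr_right fun hr => ?_
    by_cases h0 : r = 0
    · subst h0
      exact ⟨fun e => absurd (e ▸ h.trans_le (F_zero_pos_part_le u)) (lt_irrefl _),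
        fun e => absurd h (e ▸ lt_irrefl _)⟩
    · rw [hu.measure_Ioc h0, F]
  have hclosed : IsClosed S := by
    rw [hS']
    exact hu.continuousOn_tail.preimage_isClosed_of_isClosed isClosed_Icc isClosed_singleton
  have hne : S.Nonempty := by
    have hmem : a.toReal ∈ Set.Icc (u.real (Set.Ioc 1 1)) (u.real (Set.Ioc 0 1)) := by
      refine ⟨by simp, ?_⟩
      rw [measureReal_def]
      exact ENNReal.toReal_mono (measure_ne_top u _) h.le
    obtain ⟨r, hr, he⟩ := intermediate_value_Icc' zero_le_one hu.continuousOn_tail hmem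
    exact hS' ▸ ⟨r, hr, he⟩
  have hmem : sInf S ∈ S := hclosed.csInf_mem hne ⟨0, fun r hr => hr.1.1⟩
  have hcut : cutPoint j δ u = sInf S := rfl
  rw [hcut]
  refine ⟨⟨lt_of_le_of_ne hmem.1.1 fun e => ?_, hmem.1.2⟩, hmem.2⟩
  have := hmem.2
  rw [← e] at this
  exact absurd (this ▸ h.trans_le (F_zero_pos_part_le u)) (lt_irrefl _)

lemma split_at_cutPoint (hu : Admissible u) {j δ : ℝ}
    (h : ENNReal.ofReal (j * δ) < u (Set.Ioc 0 1)) {A : Set ℝ}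
    (hsub : A ⊆ Set.Icc 0 1) (hcut : Set.Ioc (cutPoint j δ u) 1 ⊆ A) :
    u A = u (A ∩ Set.Icc 0 (cutPoint j δ u)) + ENNReal.ofReal (j * δ) := by
  obtain ⟨h0, h1⟩ := hu.cutPoint_spec h
  rw [← h1, F, ← hu.measure_Ioc h0.1.ne', ← measure_inter_add_sdiff A measurableSet_Icc]
  congr 2
  ext x
  constructor
  · rintro ⟨hx, hx'⟩
    refine ⟨not_le.1 fun hle => hx' ⟨(hsub hx).1, hle⟩, (hsub hx).2⟩
  · exact fun hx => ⟨hcut hx, fun hx' => absurd hx.1 (not_lt.2 hx'.2)⟩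

/-- The cut point drops out: up to it, a tail loses exactly the mass jδ lying beyond it; past it,
both sides vanish. -/
lemma F_K (hu : Admissible u) {j δ : ℝ} (h : ENNReal.ofReal (j * δ) < u (Set.Ioc 0 1)) {r : ℝ}
    (hr : 0 < r) : F r (K j δ u) = F r u - ENNReal.ofReal (j * δ) := by
  obtain ⟨h0, h1⟩ := hu.cutPoint_spec h
  have e : F r (K j δ u) = u (Set.Icc r 1 ∩ Set.Icc 0 (cutPoint j δ u)) := by
    simp [F, K, Measure.restrict_apply measurableSet_Icc, hr]
  rw [e]
  rcases le_or_gt r (cutPoint j δ u) with hle | hgt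
  · rw [F, hu.split_at_cutPoint h (Set.Icc_subset_Icc_left hr.le)
      fun x hx => ⟨hle.trans hx.1.le, hx.2⟩, ENNReal.add_sub_cancel_right ENNReal.ofReal_ne_top]
  · rw [tsub_eq_zero_of_le (h1 ▸ F_antitone u hgt.le)]
    convert measure_empty (μ := u)
    ext x
    simp only [Set.mem_inter_iff, Set.mem_Icc, Set.mem_empty_iff_false, iff_false]
    rintro ⟨⟨h1, -⟩, -, h2⟩
    linarith

lemma F_zero_K (hu : Admissible u) {j δ : ℝ} (h : ENNReal.ofReal (j * δ) < u (Set.Ioc 0 1)) :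
    F 0 (K j δ u) = F 0 u := by
  have h0 := (hu.cutPoint_spec h).1
  have e : F 0 (K j δ u) =
      ENNReal.ofReal (j * δ) + u (Set.Icc 0 1 ∩ Set.Icc 0 (cutPoint j δ u)) := by
    simp [F, K, Measure.restrict_apply measurableSet_Icc]
  rw [e, F, hu.split_at_cutPoint h le_rfl
    fun x hx => ⟨h0.1.le.trans hx.1.le, hx.2⟩, add_comm]

lemma K_Ioc (hu : Admissible u) {j δ : ℝ} (h : ENNReal.ofReal (j * δ) < u (Set.Ioc 0 1)) :
    K j δ u (Set.Ioc 0 1) = u (Set.Ioc 0 1) - ENNReal.ofReal (j * δ) := by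
  have h0 := (hu.cutPoint_spec h).1
  have e : K j δ u (Set.Ioc 0 1) = u (Set.Ioc 0 1 ∩ Set.Icc 0 (cutPoint j δ u)) := by
    simp [K, Measure.restrict_apply measurableSet_Ioc]
  rw [e, hu.split_at_cutPoint h Set.Ioc_subset_Icc_self
    fun x hx => ⟨h0.1.trans hx.1, hx.2⟩, ENNReal.add_sub_cancel_right ENNReal.ofReal_ne_top]

protected lemma K (hu : Admissible u) (j δ : ℝ) : Admissible (K j δ u) where
  finite := by
    have := hu.finite
    unfold Barrier.K
    have : IsFiniteMeasure (ENNReal.ofReal (j * δ) • Measure.dirac (0 : ℝ)) :=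
      Measure.smul_finite _ ENNReal.ofReal_ne_top
    infer_instance
  carried := by
    have := hu.carried
    unfold Carried at this ⊢
    have h2 : u.restrict (Set.Icc 0 (cutPoint j δ u)) (Set.Icc 0 1)ᶜ = 0 :=
      le_antisymm ((Measure.restrict_apply_le _ _).trans this.le) zero_le
    simp only [Barrier.K, Measure.add_apply, h2, add_zero]
    simp
  noAtom x hx := by
    have h2 : u.restrict (Set.Icc 0 (cutPoint j δ u)) {x} = 0 :=
      le_antisymm ((Measure.restrict_apply_le _ _).trans (hu.noAtom x hx).le) zero_le
    simp only [Barrier.K, Measure.add_apply, h2, add_zero]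
    simp [hx.symm]

end Admissible

lemma withDensity_leb_singleton (f : ℝ → ℝ≥0∞) (x : ℝ) : leb.withDensity f {x} = 0 := by
  refine withDensity_absolutelyContinuous _ _ ?_
  unfold leb
  exact le_antisymm ((Measure.restrict_apply_le _ _).trans (by simp)) zero_le

lemma Admissible.neumannConv {u : Measure ℝ} (hu : Admissible u) {t : ℝ} (ht : 0 < t) :
    Admissible (neumannConv t u) where
  finite := by have := hu.finite; exact isFiniteMeasure_neumannConv ht u
  carried := carried_neumannConv t u
  noAtom x _ := withDensity_leb_singleton _ x

lemma withDensity_leb_Ioc (f : ℝ → ℝ≥0∞) :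
    leb.withDensity f (Set.Ioc 0 1) = F 0 (leb.withDensity f) := by
  refine le_antisymm (F_zero_pos_part_le _) ?_
  have : Set.Icc (0 : ℝ) 1 = {0} ∪ Set.Ioc 0 1 := by
    rw [Set.union_comm, Set.Ioc_union_left zero_le_one]
  rw [F, this]
  refine (measure_union_le _ _).trans ?_
  rw [withDensity_leb_singleton, zero_add]

/-- The flow spreads the atom at 0 into a density, so all the mass is available to the next cut.
Hence the lower barrier, which flows first, only needs jδ < F(0;u). -/
lemma Admissible.neumannConv_Ioc {u : Measure ℝ} (hu : Admissible u) {t : ℝ} (ht : 0 < t) :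
    Barrier.neumannConv t u (Set.Ioc 0 1) = F 0 u := by
  have := hu.finite
  rw [← F_zero_neumannConv ht hu.carried]
  exact withDensity_leb_Ioc _

lemma isFiniteMeasure_densityMeasure {ρ : ℝ → ℝ} (hρ : IsBddDensity ρ) :
    IsFiniteMeasure (densityMeasure ρ) := by
  have : IsFiniteMeasure leb := by unfold leb; infer_instance
  exact isFiniteMeasure_withDensity_ofReal (hρ.1.integrable le_top).2

lemma admissible_of_mem_U {u : Measure ℝ} (hu : u ∈ U) : Admissible u := by
  obtain ⟨c, ρ, -, hρ, rfl⟩ := hu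
  have := isFiniteMeasure_densityMeasure hρ
  have : IsFiniteMeasure (ENNReal.ofReal c • Measure.dirac (0 : ℝ)) :=
    Measure.smul_finite _ ENNReal.ofReal_ne_top
  refine ⟨inferInstance, ?_, fun x hx => ?_⟩
  · have h : densityMeasure ρ (Set.Icc 0 1)ᶜ = 0 := carried_withDensity_leb _
    unfold Carried
    simp only [Measure.add_apply, h, add_zero]
    simp
  · have h : densityMeasure ρ {x} = 0 := withDensity_leb_singleton _ x
    simp only [Measure.add_apply, h, add_zero]
    simp [hx.symm]

lemma admissible_of_mem_UDelta {j δ : ℝ} {u : Measure ℝ} (hu : u ∈ UDelta j δ) :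
    Admissible u := by
  obtain ⟨c, ρ, hc, hρ, rfl, -⟩ := hu
  exact admissible_of_mem_U ⟨c, ρ, hc, hρ, rfl⟩

lemma lt_measure_Ioc_of_mem_UDelta {j δ : ℝ} {u : Measure ℝ} (hu : u ∈ UDelta j δ) :
    ENNReal.ofReal (j * δ) < u (Set.Ioc 0 1) := by
  obtain ⟨c, ρ, -, -, rfl, h⟩ := hu
  rw [← show densityMeasure ρ (Set.Ioc 0 1) = F 0 (densityMeasure ρ) from withDensity_leb_Ioc _] at h
  refine h.trans_le ?_
  rw [Measure.add_apply]
  exact le_add_self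

lemma densityMeasure_mem_UDelta {j δ : ℝ} {ρ : ℝ → ℝ} (hρ : IsBddDensity ρ)
    (h : ENNReal.ofReal (j * δ) < F 0 (densityMeasure ρ)) : densityMeasure ρ ∈ UDelta j δ :=
  ⟨0, ρ, le_rfl, hρ, by simp, h⟩

end Barrier

/-! ### Order properties and comparison of the barriers -/

namespace Barrier

open scoped ENNReal

lemma MassLE.refl (u : Measure ℝ) : MassLE u u := fun _ _ => le_rfl

lemma MassLE.trans {u v w : Measure ℝ} (h : MassLE u v) (h' : MassLE v w) : MassLE u w :=
  fun r hr => (h r hr).trans (h' r hr)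

section

variable {u v : Measure ℝ} {j δ t : ℝ}

lemma MassLE.neumannConv (ht : 0 < t) (hu : Admissible u) (hv : Admissible v)
    (h : MassLE u v) : MassLE (neumannConv t u) (neumannConv t v) := fun r _ => by
  have := hu.finite
  have := hv.finite
  simpa using F_neumannConv_le ht hu.carried (b := 0) (by simp only [add_zero]; exact h) r

lemma MassLE.K (hu : Admissible u) (hv : Admissible v)
    (hu' : ENNReal.ofReal (j * δ) < u (Set.Ioc 0 1))
    (hv' : ENNReal.ofReal (j * δ) < v (Set.Ioc 0 1)) (h : MassLE u v) :
    MassLE (K j δ u) (K j δ v) := fun r hr => by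
  rcases hr.1.eq_or_lt with rfl | h0
  · rw [hu.F_zero_K hu', hv.F_zero_K hv']
    exact h 0 hr
  · rw [hu.F_K hu' h0, hv.F_K hv' h0]
    exact tsub_le_tsub_right (h r hr) _

lemma F_le_F_K_add (hu : Admissible u) (hu' : ENNReal.ofReal (j * δ) < u (Set.Ioc 0 1)) {r : ℝ}
    (hr : 0 ≤ r) : F r u ≤ F r (K j δ u) + ENNReal.ofReal (j * δ) := by
  rcases hr.eq_or_lt with rfl | h0
  · rw [hu.F_zero_K hu']
    exact le_self_add
  · rw [hu.F_K hu' h0]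
    exact le_tsub_add

/-- Cutting before the heat flow dominates cutting after it. -/
lemma K_neumannConv_le (ht : 0 < t) (hu : Admissible u)
    (hu' : ENNReal.ofReal (j * δ) < u (Set.Ioc 0 1)) :
    MassLE (K j δ (neumannConv t u)) (neumannConv t (K j δ u)) := fun r hr => by
  have := hu.finite
  have := (hu.K j δ).finite
  have hG : ENNReal.ofReal (j * δ) < neumannConv t u (Set.Ioc 0 1) := by
    rw [hu.neumannConv_Ioc ht]
    exact hu'.trans_le (F_zero_pos_part_le u)
  rcases hr.1.eq_or_lt with rfl | h0
  · rw [(hu.neumannConv ht).F_zero_K hG, F_zero_neumannConv ht hu.carried,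
      F_zero_neumannConv ht (hu.K j δ).carried, hu.F_zero_K hu']
  -- The subtracted jδ becomes a constant defect, already present between u and K u before the flow.
  · rw [(hu.neumannConv ht).F_K hG h0, tsub_le_iff_right]
    exact F_neumannConv_le ht hu.carried (fun s hs => F_le_F_K_add hu hu' hs.1) r

lemma lowerBarrier_spec (hδ : 0 < δ) (hu : Admissible u)
    (hu' : ENNReal.ofReal (j * δ) < F 0 u) (n : ℕ) :
    Admissible (lowerBarrier j δ n u) ∧ F 0 (lowerBarrier j δ n u) = F 0 u := by
  induction n with
  | zero => exact ⟨hu, rfl⟩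
  | succ n ih =>
    have := ih.1.finite
    refine ⟨(ih.1.neumannConv hδ).K j δ, ?_⟩
    rw [lowerBarrier, (ih.1.neumannConv hδ).F_zero_K (by rwa [ih.1.neumannConv_Ioc hδ, ih.2]),
      F_zero_neumannConv hδ ih.1.carried, ih.2]

lemma upperBarrier_spec (hδ : 0 < δ) (hu : Admissible u)
    (hu' : ENNReal.ofReal (j * δ) < u (Set.Ioc 0 1)) (n : ℕ) :
    Admissible (upperBarrier j δ n u) ∧
      ENNReal.ofReal (j * δ) < upperBarrier j δ n u (Set.Ioc 0 1) := by
  induction n with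
  | zero => exact ⟨hu, hu'⟩
  | succ n ih =>
    refine ⟨(ih.1.K j δ).neumannConv hδ, ?_⟩
    rw [upperBarrier, (ih.1.K j δ).neumannConv_Ioc hδ, ih.1.F_zero_K ih.2]
    exact ih.2.trans_le (F_zero_pos_part_le _)

lemma MassLE.lowerBarrier (hδ : 0 < δ) (hu : Admissible u) (hv : Admissible v)
    (hu' : ENNReal.ofReal (j * δ) < F 0 u) (hv' : ENNReal.ofReal (j * δ) < F 0 v)
    (h : MassLE u v) (n : ℕ) : MassLE (lowerBarrier j δ n u) (lowerBarrier j δ n v) := by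
  induction n with
  | zero => exact h
  | succ n ih =>
    obtain ⟨a1, b1⟩ := lowerBarrier_spec hδ hu hu' n
    obtain ⟨a2, b2⟩ := lowerBarrier_spec hδ hv hv' n
    exact (ih.neumannConv hδ a1 a2).K (a1.neumannConv hδ) (a2.neumannConv hδ)
      (by rwa [a1.neumannConv_Ioc hδ, b1]) (by rwa [a2.neumannConv_Ioc hδ, b2])

lemma MassLE.upperBarrier (hδ : 0 < δ) (hu : Admissible u) (hv : Admissible v)
    (hu' : ENNReal.ofReal (j * δ) < u (Set.Ioc 0 1))
    (hv' : ENNReal.ofReal (j * δ) < v (Set.Ioc 0 1)) (h : MassLE u v) (n : ℕ) :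
    MassLE (upperBarrier j δ n u) (upperBarrier j δ n v) := by
  induction n with
  | zero => exact h
  | succ n ih =>
    obtain ⟨a1, b1⟩ := upperBarrier_spec hδ hu hu' n
    obtain ⟨a2, b2⟩ := upperBarrier_spec hδ hv hv' n
    exact (ih.K a1 a2 b1 b2).neumannConv hδ (a1.K j δ) (a2.K j δ)

/-- With S⁻ ≤ S⁺ after n steps, K G S⁻ ≤ K G S⁺ ≤ G K S⁺. -/
lemma lowerBarrier_le_upperBarrier (hδ : 0 < δ) (hu : Admissible u)
    (hu' : ENNReal.ofReal (j * δ) < u (Set.Ioc 0 1)) (n : ℕ) :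
    MassLE (lowerBarrier j δ n u) (upperBarrier j δ n u) := by
  have hF := hu'.trans_le (F_zero_pos_part_le u)
  induction n with
  | zero => exact MassLE.refl u
  | succ n ih =>
    obtain ⟨a1, b1⟩ := lowerBarrier_spec hδ hu hF n
    obtain ⟨a2, b2⟩ := upperBarrier_spec hδ hu hu' n
    refine MassLE.trans ?_ (K_neumannConv_le hδ a2 b2)
    refine (ih.neumannConv hδ a1 a2).K (a1.neumannConv hδ) (a2.neumannConv hδ)
      (by rwa [a1.neumannConv_Ioc hδ, b1]) ?_
    rw [a2.neumannConv_Ioc hδ]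
    exact b2.trans_le (F_zero_pos_part_le _)

lemma lowerBarrier_add (j δ : ℝ) (n p : ℕ) (u : Measure ℝ) :
    lowerBarrier j δ (n + p) u = lowerBarrier j δ p (lowerBarrier j δ n u) := by
  induction p with
  | zero => rfl
  | succ p ih => rw [← add_assoc, lowerBarrier, lowerBarrier, ih]

lemma upperBarrier_add (j δ : ℝ) (n p : ℕ) (u : Measure ℝ) :
    upperBarrier j δ (n + p) u = upperBarrier j δ p (upperBarrier j δ n u) := by
  induction p with
  | zero => rfl
  | succ p ih => rw [← add_assoc, upperBarrier, upperBarrier, ih]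

/-- Each cut adds at most jδ to the defect, and the flow does not enlarge it. Induction starts at
one step because the kernel formula at time 0 does not give the identity. -/
lemma F_neumannConv_le_lowerBarrier (hj : 0 < j) (hδ : 0 < δ) (hu : Admissible u)
    (hu' : ENNReal.ofReal (j * δ) < F 0 u) (i : ℕ) :
    ∀ r ∈ Set.Icc (0 : ℝ) 1, F r (neumannConv ((i + 1) * δ) u) ≤
      F r (lowerBarrier j δ (i + 1) u) + ENNReal.ofReal (j * ((i + 1) * δ)) := by
  have := hu.finite
  induction i with
  | zero =>
    intro r hr
    have := F_le_F_K_add (j := j) (δ := δ) (hu.neumannConv hδ)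
      (by rwa [hu.neumannConv_Ioc hδ]) hr.1
    simpa [lowerBarrier] using this
  | succ i ih =>
    intro r hr
    have hi : 0 < ((i : ℝ) + 1) * δ := by positivity
    obtain ⟨a1, b1⟩ := lowerBarrier_spec hδ hu hu' (i + 1)
    have := a1.finite
    have := (hu.neumannConv hi).finite
    have h1 := F_neumannConv_le hδ (hu.neumannConv hi).carried ih r
    rw [F_neumannConv_neumannConv hδ hi] at h1
    have h2 := F_le_F_K_add (j := j) (δ := δ) (a1.neumannConv hδ)
      (by rwa [a1.neumannConv_Ioc hδ, b1]) hr.1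
    have e1 : ((i + 1 : ℕ) + 1 : ℝ) * δ = (i + 1) * δ + δ := by push_cast; ring
    rw [e1, mul_add, ENNReal.ofReal_add (by positivity) (by positivity),
      add_comm (ENNReal.ofReal _), ← add_assoc]
    exact h1.trans (add_le_add_left h2 _)

/-- One coarse lower step is dominated by the corresponding fine lower steps. -/
lemma K_neumannConv_le_lowerBarrier (hj : 0 < j) (hδ : 0 < δ) (hu : Admissible u) (i : ℕ)
    (hu' : ENNReal.ofReal (j * ((i + 1) * δ)) < F 0 u) :
    MassLE (K j ((i + 1) * δ) (neumannConv ((i + 1) * δ) u)) (lowerBarrier j δ (i + 1) u) := by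
  have := hu.finite
  have hi : 0 < ((i : ℝ) + 1) * δ := by positivity
  have hu'' : ENNReal.ofReal (j * δ) < F 0 u := by
    refine lt_of_le_of_lt (ENNReal.ofReal_le_ofReal ?_) hu'
    have : 0 ≤ j * ((i : ℝ) * δ) := by positivity
    linarith
  have hG : ENNReal.ofReal (j * ((i + 1) * δ)) <
      neumannConv ((i + 1) * δ) u (Set.Ioc 0 1) := by
    rwa [hu.neumannConv_Ioc hi]
  intro r hr
  rcases hr.1.eq_or_lt with rfl | h0
  · rw [(hu.neumannConv hi).F_zero_K hG, F_zero_neumannConv hi hu.carried,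
      (lowerBarrier_spec hδ hu hu'' _).2]
  · rw [(hu.neumannConv hi).F_K hG h0, tsub_le_iff_right]
    exact F_neumannConv_le_lowerBarrier hj hδ hu hu'' i r hr

/-- Two successive cuts have the same tails as a single larger cut. -/
lemma K_K_le {s : ℝ} (hj : 0 < j) (hδ : 0 < δ) (hs : 0 < s) (hu : Admissible u)
    (hu' : ENNReal.ofReal (j * (s + δ)) < u (Set.Ioc 0 1)) :
    ENNReal.ofReal (j * δ) < K j s u (Set.Ioc 0 1) ∧
      MassLE (K j δ (K j s u)) (K j (s + δ) u) := by
  have e : ENNReal.ofReal (j * (s + δ)) = ENNReal.ofReal (j * s) + ENNReal.ofReal (j * δ) := by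
    rw [mul_add, ENNReal.ofReal_add (by positivity) (by positivity)]
  have h1 : ENNReal.ofReal (j * s) < u (Set.Ioc 0 1) :=
    lt_of_le_of_lt (e ▸ le_self_add) hu'
  have h2 : ENNReal.ofReal (j * δ) < K j s u (Set.Ioc 0 1) := by
    rw [hu.K_Ioc h1, lt_tsub_iff_left, ← e]
    exact hu'
  refine ⟨h2, fun r hr => ?_⟩
  rcases hr.1.eq_or_lt with rfl | h0
  · rw [(hu.K j s).F_zero_K h2, hu.F_zero_K h1, hu.F_zero_K hu']
  · rw [(hu.K j s).F_K h2 h0, hu.F_K h1 h0, hu.F_K hu' h0, e, tsub_tsub]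

/-- Fine upper steps are dominated by the corresponding coarse upper step. -/
lemma upperBarrier_le_neumannConv_K (hj : 0 < j) (hδ : 0 < δ) (hu : Admissible u) (i : ℕ)
    (hu' : ENNReal.ofReal (j * ((i + 1) * δ)) < u (Set.Ioc 0 1)) :
    MassLE (upperBarrier j δ (i + 1) u) (neumannConv ((i + 1) * δ) (K j ((i + 1) * δ) u)) := by
  induction i with
  | zero => simpa [upperBarrier] using MassLE.refl _
  | succ i ih =>
    set s : ℝ := (i + 1) * δ with hs
    have hs0 : 0 < s := by positivity
    have e1 : ((i + 1 : ℕ) + 1 : ℝ) * δ = s + δ := by rw [hs]; push_cast; ring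
    rw [e1] at hu' ⊢
    obtain ⟨c1, c2⟩ := K_K_le hj hδ hs0 hu hu'
    have h1 : ENNReal.ofReal (j * s) < u (Set.Ioc 0 1) :=
      lt_of_le_of_lt (ENNReal.ofReal_le_ofReal (by nlinarith)) hu'
    have h2 : ENNReal.ofReal (j * δ) < u (Set.Ioc 0 1) :=
      lt_of_le_of_lt (ENNReal.ofReal_le_ofReal (by nlinarith)) hu'
    obtain ⟨a1, b1⟩ := upperBarrier_spec hδ hu h2 (i + 1)
    have hy := hu.K j s
    have hGy := hy.neumannConv hs0
    have bGy : ENNReal.ofReal (j * δ) < neumannConv s (K j s u) (Set.Ioc 0 1) := by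
      rw [hy.neumannConv_Ioc hs0]
      exact c1.trans_le (F_zero_pos_part_le _)
    -- With s the time elapsed, the chain is G_δ K_δ S⁺ ≤ G_δ K_δ G_s K_s u ≤ G_δ G_s K_δ K_s u ≤
    -- G_{s+δ} K_{s+δ} u.
    have s1 := ((ih h1).K a1 hGy b1 bGy).neumannConv hδ (a1.K j δ) (hGy.K j δ)
    have s2 := (K_neumannConv_le hs0 hy c1).neumannConv hδ (hGy.K j δ)
      ((hy.K j δ).neumannConv hs0)
    have s3 := c2.neumannConv (t := s + δ) (by positivity) (hy.K j δ) (hu.K j (s + δ))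
    have := (hy.K j δ).finite
    refine (s1.trans s2).trans fun r hr => ?_
    rw [F_neumannConv_neumannConv hδ hs0]
    exact s3 r hr

end

/-- Monotonicity of the coarse step moves it onto the fine state, where the one-block comparison
applies because total mass is conserved. -/
lemma lowerBarrier_coarse_le_fine {u : Measure ℝ} {j δ : ℝ} (hj : 0 < j) (hδ : 0 < δ)
    (hu : Admissible u) (i : ℕ) (hu' : ENNReal.ofReal (j * ((i + 1) * δ)) < F 0 u) (m : ℕ) :
    MassLE (lowerBarrier j ((i + 1) * δ) m u) (lowerBarrier j δ (m * (i + 1)) u) := by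
  have hi : 0 < ((i : ℝ) + 1) * δ := by positivity
  have hu'' : ENNReal.ofReal (j * δ) < F 0 u := by
    refine lt_of_le_of_lt (ENNReal.ofReal_le_ofReal ?_) hu'
    have : 0 ≤ j * ((i : ℝ) * δ) := by positivity
    linarith
  induction m with
  | zero => simpa [lowerBarrier] using MassLE.refl u
  | succ m ih =>
    obtain ⟨a1, b1⟩ := lowerBarrier_spec hi hu hu' m
    obtain ⟨a2, b2⟩ := lowerBarrier_spec hδ hu hu'' (m * (i + 1))
    rw [Nat.succ_mul, lowerBarrier_add j δ]
    refine MassLE.trans ?_ (K_neumannConv_le_lowerBarrier hj hδ a2 i (b2 ▸ hu'))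
    exact (ih.neumannConv hi a1 a2).K (a1.neumannConv hi) (a2.neumannConv hi)
      (by rwa [a1.neumannConv_Ioc hi, b1]) (by rwa [a2.neumannConv_Ioc hi, b2])

/-- Here the fine block is the monotone map: it is moved onto the coarse state, which keeps enough
mass on (0,1] for the coarse cut. -/
lemma upperBarrier_fine_le_coarse {u : Measure ℝ} {j δ : ℝ} (hj : 0 < j) (hδ : 0 < δ)
    (hu : Admissible u) (i : ℕ)
    (hu' : ENNReal.ofReal (j * ((i + 1) * δ)) < u (Set.Ioc 0 1)) (m : ℕ) :
    MassLE (upperBarrier j δ (m * (i + 1)) u) (upperBarrier j ((i + 1) * δ) m u) := by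
  have hi : 0 < ((i : ℝ) + 1) * δ := by positivity
  have hle : ENNReal.ofReal (j * δ) ≤ ENNReal.ofReal (j * ((i + 1) * δ)) := by
    refine ENNReal.ofReal_le_ofReal ?_
    have : 0 ≤ j * ((i : ℝ) * δ) := by positivity
    linarith
  induction m with
  | zero => simpa [upperBarrier] using MassLE.refl u
  | succ m ih =>
    obtain ⟨a1, b1⟩ := upperBarrier_spec hi hu hu' m
    obtain ⟨a2, b2⟩ := upperBarrier_spec hδ hu (hle.trans_lt hu') (m * (i + 1))
    rw [Nat.succ_mul, upperBarrier_add j δ]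
    exact (ih.upperBarrier hδ a2 a1 b2 (hle.trans_lt b1) (i + 1)).trans
      (upperBarrier_le_neumannConv_K hj hδ a1 i b1)

end Barrier

/-- Macroscopic inequalities between barriers. Since `δ = k δ'`, the time `m δ` is `m` steps of
length `δ` and `m * k` steps of length `δ'`. -/
theorem theorem6p3 (j : ℝ) (hj : 0 < j) :
    (∀ ρ : ℝ → ℝ, Barrier.IsBddDensity ρ →
      0 < Barrier.F 0 (Barrier.densityMeasure ρ) →
      ∀ δ δ' : ℝ, 0 < δ →
        ENNReal.ofReal (j * δ) < Barrier.F 0 (Barrier.densityMeasure ρ) →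
        ∀ k : ℕ, 0 < k → δ = k * δ' → ∀ m : ℕ,
          Barrier.MassLE (Barrier.lowerBarrier j δ m (Barrier.densityMeasure ρ))
            (Barrier.lowerBarrier j δ' (m * k) (Barrier.densityMeasure ρ)) ∧
          Barrier.MassLE (Barrier.lowerBarrier j δ' (m * k) (Barrier.densityMeasure ρ))
            (Barrier.upperBarrier j δ' (m * k) (Barrier.densityMeasure ρ)) ∧
          Barrier.MassLE (Barrier.upperBarrier j δ' (m * k) (Barrier.densityMeasure ρ))
            (Barrier.upperBarrier j δ m (Barrier.densityMeasure ρ))) ∧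
    (∀ δ : ℝ, 0 < δ → ∀ u ∈ Barrier.UDelta j δ, ∀ v ∈ Barrier.UDelta j δ,
      Barrier.MassLE u v → Barrier.MassLE (Barrier.K j δ u) (Barrier.K j δ v)) ∧
    (∀ t : ℝ, 0 < t → ∀ u ∈ Barrier.U, ∀ v ∈ Barrier.U,
      Barrier.MassLE u v → Barrier.MassLE (Barrier.neumannConv t u) (Barrier.neumannConv t v)) ∧
    (∀ δ : ℝ, 0 < δ → ∀ u ∈ Barrier.UDelta j δ, ∀ v ∈ Barrier.UDelta j δ,
      Barrier.MassLE u v → ∀ n : ℕ,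
        Barrier.MassLE (Barrier.lowerBarrier j δ n u) (Barrier.lowerBarrier j δ n v) ∧
        Barrier.MassLE (Barrier.upperBarrier j δ n u) (Barrier.upperBarrier j δ n v)) := by
  refine ⟨?_, ?_, ?_, ?_⟩
  · intro ρ hρ _ δ δ' hδ hlt k hk hkδ m
    obtain ⟨i, rfl⟩ := Nat.exists_eq_succ_of_ne_zero hk.ne'
    rw [Nat.cast_succ] at hkδ
    subst hkδ
    have hδ' : 0 < δ' := pos_of_mul_pos_right hδ (by positivity)
    have hmem := Barrier.densityMeasure_mem_UDelta hρ hlt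
    have hu := Barrier.admissible_of_mem_UDelta hmem
    have hu' := Barrier.lt_measure_Ioc_of_mem_UDelta hmem
    have hle : ENNReal.ofReal (j * δ') ≤ ENNReal.ofReal (j * ((i + 1) * δ')) := by
      refine ENNReal.ofReal_le_ofReal ?_
      have : 0 ≤ j * ((i : ℝ) * δ') := by positivity
      linarith
    exact ⟨Barrier.lowerBarrier_coarse_le_fine hj hδ' hu i hlt m,
      Barrier.lowerBarrier_le_upperBarrier hδ' hu (hle.trans_lt hu') _,
      Barrier.upperBarrier_fine_le_coarse hj hδ' hu i hu' m⟩
  · intro δ _ u hu v hv h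
    exact h.K (Barrier.admissible_of_mem_UDelta hu) (Barrier.admissible_of_mem_UDelta hv)
      (Barrier.lt_measure_Ioc_of_mem_UDelta hu) (Barrier.lt_measure_Ioc_of_mem_UDelta hv)
  · intro t ht u hu v hv h
    exact h.neumannConv ht (Barrier.admissible_of_mem_U hu) (Barrier.admissible_of_mem_U hv)
  · intro δ hδ u hu v hv h n
    have au := Barrier.admissible_of_mem_UDelta hu
    have av := Barrier.admissible_of_mem_UDelta hv
    have lu := Barrier.lt_measure_Ioc_of_mem_UDelta hu
    have lv := Barrier.lt_measure_Ioc_of_mem_UDelta hv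
    exact ⟨h.lowerBarrier hδ au av (lu.trans_le (Barrier.F_zero_pos_part_le u))
      (lv.trans_le (Barrier.F_zero_pos_part_le v)) n, h.upperBarrier hδ au av lu lv n⟩
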